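/- For a permutation $\pi$ of $\{1,\dots,n\}$, let $|\pi|=n$ and let $\mathrm{fp}(\pi)$, $\mathrm{exc}(\pi)$, $\mathrm{dexc}(\pi)$, $\mathrm{cyc}(\pi)$, $\mathrm{inv}(\pi)$ be its numbers of fixed points, of excedances ($i<\pi(i)$), of double excedances ($i<\pi(i)<\pi(\pi(i))$), of cycles (fixed points included) and of inversions. For sequences $d=(d_1,d_2,\dots)$ and $\ell=(\ell_0,\ell_1,\dots)$ let $$J_{d,\ell}(z)=\cfrac{1}{1-\ell_0z-\cfrac{d_1z^2}{1-\ell_1z-\cfrac{d_2z^2}{1-\ell_2z-\cdots}}}$$ as a formal power series in $z$. Say that $\pi$ has noncrossing cycles if there are no $i<j<k<l$ such that $i,k$ belong to one cycle of $\pi$ and $j,l$ belong to another; and that $\pi$ has unimodal cycles if every cycle, written with its smallest element first as $(a_1,\dots,a_k)$, satisfies $a_1<\dots<a_m>\dots>a_k$ for some $1\le m\le k$. Let $\mathcal A$ be the set of permutations (of all lengths $n\ge0$) with unimodal noncrossing cycles. Let $\mathcal B$ be the set of permutations with increasing excedances and increasing deficiencies, that is, such that $\pi(i)<\pi(j)$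 whenever $i<j$ and either $i<\pi(i)$ and $j<\pi(j)$, or $i>\pi(i)$ and $j>\pi(j)$. Then: 1. $\displaystyle\sum_{\pi\in\mathcal A}x^{\mathrm{fp}(\pi)}v^{\mathrm{exc}(\pi)}w^{\mathrm{dexc}(\pi)}t^{\mathrm{cyc}(\pi)}q^{\mathrm{inv}(\pi)}z^{|\pi|}=J_{d,\ell}(z)$ with $\ell_0=xt$ and, for $h\ge1$, $d_h=vt\,q^{4h-3}$ and $\ell_h=xt\,q^{2h}+(1+vw)q^{2h-1}$. 2. $\displaystyle\sum_{\pi\in\mathcal B}x^{\mathrm{fp}(\pi)}v^{\mathrm{exc}(\pi)}w^{\mathrm{dexc}(\pi)}q^{\mathrm{inv}(\pi)}z^{|\pi|}=J_{d,\ell}(z)$ with $\ell_0=x$ and, for $h\ge1$, $d_h=v\,q^{2h-1}$ and $\ell_h=x\,q^{2h}+(1+vw)q^{h}$. 3. As formal power series, $$\sum_{\pi\in\mathcal A}z^{|\pi|}=\sum_{\pi\in\mathcal B}z^{|\pi|}=J_{d,\ell}(z)=\frac{2}{1+z+\sqrt{1-6z+5z^2}},$$ where here $\ell_0=1$ and $d_h=1$,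 $\ell_h=3$ for $h\ge1$, and the square root is the one with constant term $1$. -/

import Mathlib

open Finset PowerSeries

noncomputable section

/-! Continued fractions over a commutative ring, as formal power series -/

section JFraction

variable {R : Type*} [CommRing R]

/-- The finite continued fraction with `N` levels, starting at level `h`:
`1 / (1 - ℓ_h z - d_{h+1} z² / (1 - ℓ_{h+1} z - ⋯ ))`, the `N`-th tail being replaced by `0`.
Every denominator has constant coefficient `1`. -/
def jConvergent (d l : ℕ → R) : ℕ → ℕ → R⟦X⟧
  | 0, _ => 0
  | N + 1, h =>
      invOfUnit (1 - C (l h) * X - C (d (h + 1)) * X ^ 2 * jConvergent d l N (h + 1)) 1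

/-- The Jacobi continued fraction
`J_{d,ℓ}(z) = 1 / (1 - ℓ_0 z - d_1 z² / (1 - ℓ_1 z - d_2 z² / (1 - ℓ_2 z - ⋯ )))`, i.e. the
coefficientwise limit of its finite truncations (see `coeff_jConvergent`).
The value `d 0` is not used. -/
def jFraction (d l : ℕ → R) : R⟦X⟧ :=
  PowerSeries.mk fun n => coeff n (jConvergent d l (n + 1) 0)

theorem jConvergent_succ_mul (d l : ℕ → R) (N h : ℕ) :
    (1 - C (l h) * X - C (d (h + 1)) * X ^ 2 * jConvergent d l N (h + 1)) *
      jConvergent d l (N + 1) h = 1 := by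
  rw [jConvergent]
  exact mul_invOfUnit _ _ (by simp)

theorem X_pow_dvd_jConvergent_sub (d l : ℕ → R) (N M h : ℕ) (hNM : N ≤ M) :
    (X : R⟦X⟧) ^ N ∣ jConvergent d l M h - jConvergent d l N h := by
  induction N generalizing M h with
  | zero => simp
  | succ N ih =>
    obtain ⟨M, rfl⟩ : ∃ M', M = M' + 1 := ⟨M - 1, by omega⟩
    obtain ⟨c, hc⟩ := ih M (h + 1) (by omega)
    have h1 := jConvergent_succ_mul d l N h
    have h2 := jConvergent_succ_mul d l M h
    refine ⟨jConvergent d l (M + 1) h * jConvergent d l (N + 1) h * C (d (h + 1)) * X * c, ?_⟩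
    linear_combination (-jConvergent d l (M + 1) h) * h1 + jConvergent d l (N + 1) h * h2 +
      jConvergent d l (M + 1) h * jConvergent d l (N + 1) h * C (d (h + 1)) * X ^ 2 * hc

/-- The truncations converge coefficientwise to the continued fraction. -/
theorem coeff_jConvergent (d l : ℕ → R) (n N : ℕ) (hN : n < N) :
    coeff n (jConvergent d l N 0) = coeff n (jFraction d l) := by
  have h := X_pow_dvd_jConvergent_sub d l (n + 1) N 0 hN
  have h' := X_pow_dvd_iff.mp h n (Nat.lt_succ_self n)
  rw [map_sub, sub_eq_zero] at h'
  rw [h', jFraction, coeff_mk]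

end JFraction

/-! Permutation statistics -/

section Statistics

variable {n : ℕ}

/-- Number of fixed points. -/
def fpCount (π : Equiv.Perm (Fin n)) : ℕ := #{i | π i = i}

/-- Number of excedances `i < π(i)`. -/
def excCount (π : Equiv.Perm (Fin n)) : ℕ := #{i | i < π i}

/-- Number of double excedances `i < π(i) < π(π(i))`. -/
def dexcCount (π : Equiv.Perm (Fin n)) : ℕ := #{i | i < π i ∧ π i < π (π i)}

/-- Number of cycles, fixed points included. -/
def cycCount (π : Equiv.Perm (Fin n)) : ℕ := #π.cycleFactorsFinset + fpCount π

/-- Number of inversions. -/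
def invCount (π : Equiv.Perm (Fin n)) : ℕ :=
  #{p : Fin n × Fin n | p.1 < p.2 ∧ π p.2 < π p.1}

/-- The partition of the ground set into the cycles of `π` is noncrossing. -/
def NoncrossingCycles (π : Equiv.Perm (Fin n)) : Prop :=
  ¬ ∃ i j k l : Fin n, i < j ∧ j < k ∧ k < l ∧
    π.SameCycle i k ∧ π.SameCycle j l ∧ ¬ π.SameCycle i j

/-- Every cycle of `π` is unimodal: written with its smallest element first, as
`(a, π a, π² a, …, π^(k-1) a)` where `k` is its length, it increases up to some position `m < k`
and decreases from there on. -/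
def UnimodalCycles (π : Equiv.Perm (Fin n)) : Prop :=
  ∀ a : Fin n, (∀ b, π.SameCycle a b → a ≤ b) →
    ∃ m < Function.minimalPeriod π a,
      StrictMonoOn (fun j : ℕ => (π ^ j) a) (Set.Iic m) ∧
      StrictAntiOn (fun j : ℕ => (π ^ j) a) (Set.Ico m (Function.minimalPeriod π a))

/-- The excedances `π(i) > i`, read from left to right, increase. -/
def IncreasingExcedances (π : Equiv.Perm (Fin n)) : Prop :=
  ∀ i j : Fin n, i < j → i < π i → j < π j → π i < π j

/-- The deficiencies `π(i) < i`, read from left to right, increase. -/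
def IncreasingDeficiencies (π : Equiv.Perm (Fin n)) : Prop :=
  ∀ i j : Fin n, i < j → π i < i → π j < j → π i < π j

end Statistics

open Classical in
/-- The generating function `∑ wt(π) z^n` over all `n ≥ 0` and all permutations `π` of an
`n`-element linearly ordered set that satisfy `P`. -/
def permGF {R : Type*} [CommRing R] (P : ∀ n : ℕ, Equiv.Perm (Fin n) → Prop)
    (wt : ∀ n : ℕ, Equiv.Perm (Fin n) → R) : R⟦X⟧ :=
  PowerSeries.mk fun n => ∑ π : Equiv.Perm (Fin n) with P n π, wt n π

end

/-! ### Continued fractions and Motzkin path recursions -/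

section ContinuedFraction

variable {R : Type*} [CommRing R]

/-! Both families are handled by one bijection with weighted Motzkin paths. Draw `i ↦ π i` as an
arc, excedances and deficiencies separately. The local shape at each point (fixed, opening, closing,
or passing) gives a step, and the height before `i` is the number of excedance arcs open there,
which equals the number of open deficiency arcs. The path forgets only which open arc is closed at
each closing point. Prescribing the rank `κ h` of that arc among the `h` open ones, for `π` and for
its inverse, makes `π` recoverable from its path (`ExcedanceRank.ext`), and every admissible path
occurs (`exists_excedanceRank`).

All statistics are local on such permutations: inversions are sums of heights plus nestings of arcs
(`invCount_eq`), and nestings are exactly the prescribed ranks. Summing over paths gives one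
continued fraction for every `κ` (`permGF_excedanceRank`).

Rank `0` (close the leftmost source) means increasing excedances and deficiencies. Rank `h - 1`
(close the rightmost source) means that neither kind of arc crosses, which is equivalent to unimodal
noncrossing cycles (`unimodal_noncrossing_iff`). Such cycles, if not fixed points, have exactly one
valley each, so the weight `t` can be placed on fixed points and up steps. At all weights `1` the
fraction is periodic from level 1 on, hence quadratic. -/

/-- The tail `1 / (1 - ℓ_h z - d_{h+1} z² / (1 - ⋯))` of a Jacobi continued fraction. -/
noncomputable def jTail (d l : ℕ → R) (h : ℕ) : R⟦X⟧ :=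
  PowerSeries.mk fun n => coeff n (jConvergent d l (n + 1) h)

theorem jTail_zero (d l : ℕ → R) : jTail d l 0 = jFraction d l := rfl

theorem X_pow_dvd_jTail_sub (d l : ℕ → R) (N h : ℕ) :
    (X : R⟦X⟧) ^ N ∣ jTail d l h - jConvergent d l N h := by
  rw [X_pow_dvd_iff]
  intro m hm
  have h' := X_pow_dvd_iff.mp (X_pow_dvd_jConvergent_sub d l (m + 1) N h hm) m (Nat.lt_succ_self m)
  rw [map_sub, sub_eq_zero] at h'
  rw [map_sub, h', jTail, coeff_mk, sub_self]

/-- The limit of `jConvergent_succ_mul`: replacing convergents by tails changes the product by a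
multiple of `X ^ N`, for every `N`. -/
theorem jTail_mul (d l : ℕ → R) (h : ℕ) :
    (1 - C (l h) * X - C (d (h + 1)) * X ^ 2 * jTail d l (h + 1)) * jTail d l h = 1 := by
  have key : ∀ N, (X : R⟦X⟧) ^ N ∣
      (1 - C (l h) * X - C (d (h + 1)) * X ^ 2 * jTail d l (h + 1)) * jTail d l h - 1 := by
    intro N
    obtain ⟨c, hc⟩ := X_pow_dvd_jTail_sub d l N (h + 1)
    obtain ⟨c', hc'⟩ := X_pow_dvd_jTail_sub d l (N + 1) h
    have h1 := jConvergent_succ_mul d l N h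
    refine ⟨(1 - C (l h) * X - C (d (h + 1)) * X ^ 2 * jTail d l (h + 1)) * X * c'
      - C (d (h + 1)) * X ^ 2 * c * jConvergent d l (N + 1) h, ?_⟩
    linear_combination h1 +
      (1 - C (l h) * X - C (d (h + 1)) * X ^ 2 * jTail d l (h + 1)) * hc'
      - C (d (h + 1)) * X ^ 2 * jConvergent d l (N + 1) h * hc
  ext n
  have := X_pow_dvd_iff.mp (key (n + 1)) n (Nat.lt_succ_self n)
  rwa [map_sub, sub_eq_zero] at this

/-- The coefficients of a Jacobi continued fraction satisfy the recursion of weighted Motzkin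
paths, in which a level, up or down step starting at height `h` has weight `l h`, `u h`, `e h`. -/
theorem coeff_jFraction_of_recursion {d l u e : ℕ → R} (hd : ∀ h, d (h + 1) = u h * e (h + 1))
    {W : ℕ → ℕ → R} (W_zero_zero : W 0 0 = 1) (W_zero_succ : ∀ h, W 0 (h + 1) = 0)
    (W_succ_zero : ∀ n, W (n + 1) 0 = l 0 * W n 0 + u 0 * W n 1)
    (W_succ_succ : ∀ n h, W (n + 1) (h + 1) =
      l (h + 1) * W n (h + 1) + u (h + 1) * W n (h + 2) + e (h + 1) * W n h) (n : ℕ) :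
    coeff n (jFraction d l) = W n 0 := by
  -- The series of paths from height `h` to `0`, cut at the first descents to `h - 1, …, 0`: the
  -- piece starting at height `k` stays at or above `k` and contributes `jTail d l k`.
  let G : ℕ → R⟦X⟧ := fun h =>
    C (∏ k ∈ range h, e (k + 1)) * X ^ h * ∏ k ∈ range (h + 1), jTail d l k
  have G_zero : G 0 = jFraction d l := by simp [G, jTail_zero]
  have G_rec_zero : G 0 = 1 + X * (C (l 0) * G 0 + C (u 0) * G 1) := by
    have h1 := jTail_mul d l 0
    simp only [G, hd, map_mul, prod_range_succ, prod_range_zero, map_one] at h1 ⊢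
    linear_combination h1
  have G_rec_succ : ∀ h, G (h + 1) =
      X * (C (l (h + 1)) * G (h + 1) + C (u (h + 1)) * G (h + 2) + C (e (h + 1)) * G h) := by
    intro h
    have h1 := jTail_mul d l (h + 1)
    simp only [G, hd, map_mul, prod_range_succ, pow_succ] at h1 ⊢
    linear_combination (C (∏ k ∈ range h, e (k + 1)) * X ^ h * C (e (h + 1)) * X *
      (∏ k ∈ range h, jTail d l k) * jTail d l h) * h1
  have key : ∀ n h, coeff n (G h) = W n h := by
    intro n
    induction n with
    | zero =>
      rintro (_ | h)
      · rw [G_rec_zero]; simp [W_zero_zero]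
      · rw [G_rec_succ]; simp [W_zero_succ]
    | succ n ih =>
      rintro (_ | h)
      · rw [G_rec_zero]
        simp [coeff_succ_X_mul, coeff_one, ih, W_succ_zero]
      · rw [G_rec_succ]
        simp [coeff_succ_X_mul, ih, W_succ_succ]
  rw [← G_zero, key]

end ContinuedFraction

/-! ### Motzkin paths as words of steps -/

section Words

/-- Local shapes of a permutation at a point: `none` is a fixed point, and `some (a, b)` a point
`i` moved by `π`, with `a` telling whether `i < π i` and `b` whether `i < π⁻¹ i`. Read as steps of
a path, `some (true, true)` goes up, `some (false, false)` goes down, the others are level. -/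
abbrev StepType := Option (Bool × Bool)

/-- The height difference of a step. -/
def stepRise : StepType → ℤ
  | none => 0
  | some (a, b) => (if a then 1 else 0) - (if b then 0 else 1)

/-- The height reached by a path before step number `k`. -/
def wordHeight {n : ℕ} (w : Fin n → StepType) (k : ℕ) : ℤ :=
  ∑ j : Fin n, if (j : ℕ) < k then stepRise (w j) else 0

theorem wordHeight_cons_zero {n : ℕ} (s : StepType) (w : Fin n → StepType) :
    wordHeight (Fin.cons s w : Fin (n + 1) → StepType) 0 = 0 := by
  simp [wordHeight]

theorem wordHeight_cons_succ {n : ℕ} (s : StepType) (w : Fin n → StepType) (k : ℕ) :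
    wordHeight (Fin.cons s w : Fin (n + 1) → StepType) (k + 1) =
      stepRise s + wordHeight w k := by
  simp [wordHeight, Fin.sum_univ_succ]

variable {R : Type*} [CommRing R]

/-- The sum of the weights of all paths of `n` steps from height `h` to height `0`. -/
def wordSum (ω : ℕ → StepType → R) (n h : ℕ) : R :=
  ∑ w : Fin n → StepType, if (h : ℤ) + wordHeight w n = 0 then
    ∏ i : Fin n, ω ((h : ℤ) + wordHeight w i).toNat (w i) else 0

theorem wordSum_zero (ω : ℕ → StepType → R) (h : ℕ) :
    wordSum ω 0 h = if h = 0 then 1 else 0 := by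
  simp [wordSum, wordHeight]

/-- The next height `g s` has to be correct only for steps of nonzero weight. Paths therefore need
no nonnegativity condition: a zero weight for the down step at height `0` discards the bad ones. -/
theorem wordSum_succ (ω : ℕ → StepType → R) (n h : ℕ) (g : StepType → ℕ)
    (hg : ∀ s, ω h s ≠ 0 → (g s : ℤ) = h + stepRise s) :
    wordSum ω (n + 1) h = ∑ s, ω h s * wordSum ω n (g s) := by
  unfold wordSum
  rw [← (Fin.consEquiv (fun _ => StepType)).sum_comp, Fintype.sum_prod_type]
  refine sum_congr rfl fun s _ => ?_
  rw [mul_sum]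
  refine sum_congr rfl fun w _ => ?_
  have hcons : Fin.consEquiv (fun _ => StepType) (s, w) =
      (Fin.cons s w : Fin (n + 1) → StepType) := rfl
  simp only [hcons, wordHeight_cons_succ, Fin.prod_univ_succ, Fin.cons_zero,
    Fin.cons_succ, Fin.val_zero, Fin.val_succ, wordHeight_cons_zero, add_zero, Int.toNat_natCast]
  by_cases h0 : ω h s = 0
  · simp [h0]
  · simp only [hg s h0, add_assoc, mul_ite, mul_zero]

theorem coeff_jFraction_eq_wordSum {d l : ℕ → R} {ω : ℕ → StepType → R}
    (h00 : ω 0 (some (true, false)) = 0) (h01 : ω 0 (some (false, true)) = 0)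
    (h02 : ω 0 (some (false, false)) = 0)
    (hd : ∀ h, d (h + 1) = ω h (some (true, true)) * ω (h + 1) (some (false, false)))
    (hl : ∀ h, l h = ω h none + ω h (some (true, false)) + ω h (some (false, true))) (n : ℕ) :
    coeff n (jFraction d l) = wordSum ω n 0 := by
  refine coeff_jFraction_of_recursion (u := fun h => ω h (some (true, true)))
    (e := fun h => ω h (some (false, false))) hd ?_ ?_ ?_ ?_ n
  · simp [wordSum_zero]
  · simp [wordSum_zero]
  · intro n
    rw [wordSum_succ ω n 0 fun s => (stepRise s).toNat]
    · simp [Fintype.sum_option, Fintype.sum_prod_type, h00, h01, h02, hl, stepRise]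
    · rintro (_ | ⟨_ | _, _ | _⟩) <;> simp [stepRise, h00, h01, h02]
  · intro n h
    rw [wordSum_succ ω n (h + 1) fun s => ((h + 1 : ℕ) + stepRise s).toNat]
    · have h1 : ((h : ℤ) + 1).toNat = h + 1 := by omega
      have h2 : ((h : ℤ) + 1 + 1).toNat = h + 2 := by omega
      simp [Fintype.sum_option, Fintype.sum_prod_type, hl, stepRise, h1, h2]
      ring
    · rintro (_ | ⟨_ | _, _ | _⟩) _ <;> simp [stepRise]; omega

end Words

/-! ### Matching sources to targets by a rank rule -/

section Matching

/-- Scanning the targets in `T` from left to right, each can be matched with the source of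
prescribed rank `κ h` among the `h` sources to its left that are still available. -/
theorem exists_matching {α : Type*} [LinearOrder α] {κ : ℕ → ℕ} (hκ : ∀ h, 0 < h → κ h < h)
    (T S : Finset α) (hcard : #S = #T)
    (hdom : ∀ t ∈ T, #{t' ∈ T | t' ≤ t} ≤ #{s ∈ S | s < t}) :
    ∃ f : α → α, Set.BijOn f S T ∧ (∀ s ∈ S, s < f s) ∧
      ∀ s ∈ S, #{a ∈ S | a < s ∧ f s < f a} = κ #{a ∈ S | a < f s ∧ f s ≤ f a} := by
  induction T using Finset.induction_on_min generalizing S with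
  | empty =>
    obtain rfl : S = ∅ := by simpa using hcard
    exact ⟨id, by simp⟩
  | insert t T ht ih =>
    have htT : t ∉ T := fun h => lt_irrefl _ (ht t h)
    have hpos : 0 < #{s ∈ S | s < t} :=
      (card_pos.mpr ⟨t, by simp⟩).trans_le (hdom t (mem_insert_self _ _))
    set O := {s ∈ S | s < t} with hO
    -- The smallest target `t` has all of `O` available, and its source is forced to be the element
    -- of rank `κ #O`.
    obtain ⟨s, hsO, hrank⟩ : ∃ s ∈ O, #{a ∈ O | a < s} = κ #O := by
      let g := O.orderEmbOfFin rfl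
      refine ⟨g ⟨κ #O, hκ _ hpos⟩, O.orderEmbOfFin_mem rfl _, ?_⟩
      have : {a ∈ O | a < g ⟨κ #O, hκ _ hpos⟩} =
          (Finset.Iio (⟨κ #O, hκ _ hpos⟩ : Fin #O)).map g.toEmbedding := by
        ext a
        simp only [mem_filter, mem_map, mem_Iio, RelEmbedding.coe_toEmbedding]
        constructor
        · rintro ⟨ha, hlt⟩
          obtain ⟨j, rfl⟩ : a ∈ Set.range g := by
            rw [O.range_orderEmbOfFin rfl]; exact ha
          exact ⟨j, g.lt_iff_lt.mp hlt, rfl⟩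
        · rintro ⟨j, hj, rfl⟩
          exact ⟨O.orderEmbOfFin_mem rfl _, g.lt_iff_lt.mpr hj⟩
      rw [this, card_map, Fin.card_Iio]
    obtain ⟨hsS, hst⟩ : s ∈ S ∧ s < t := by simpa [hO] using hsO
    obtain ⟨f, hf, hlt, hfr⟩ := ih (S.erase s)
      (by rw [card_erase_of_mem hsS, hcard, card_insert_of_notMem htT]; simp) (by
        intro t' ht'
        have h1 := hdom t' (mem_insert_of_mem ht')
        rw [filter_insert, if_pos (ht t' ht').le, card_insert_of_notMem (by simp [htT])] at h1
        rw [filter_erase, card_erase_of_mem (by simp [hsS, hst.trans (ht t' ht')])]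
        omega)
    have hne : ∀ a ∈ S, a ≠ s → Function.update f s t a = f a ∧ t < f a := by
      intro a ha has
      exact ⟨Function.update_of_ne has _ _, ht _ (hf.mapsTo (by simp [ha, has]))⟩
    refine ⟨Function.update f s t, ?_, ?_, ?_⟩
    · have h1 : Set.BijOn (Function.update f s t) (S.erase s : Finset α) T := by
        refine hf.congr fun a ha => ?_
        simp only [coe_erase, Set.mem_sdiff, mem_coe, Set.mem_singleton_iff] at ha
        exact (hne a ha.1 ha.2).1.symm
      have h2 := h1.insert (a := s) (by simpa using htT)
      simpa [Set.insert_eq_of_mem, hsS] using h2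
    · intro a ha
      by_cases has : a = s
      · subst has; simpa using hst
      · rw [(hne a ha has).1]; exact hlt a (by simp [ha, has])
    · intro a ha
      by_cases has : a = s
      · subst has
        rw [Function.update_self]
        -- All other sources are sent beyond `t`, so both counts at `t` reduce to counts in `O`.
        have e1 : {b ∈ S | b < a ∧ t < Function.update f a t b} = {b ∈ O | b < a} := by
          ext b
          simp only [hO, mem_filter, and_assoc]
          refine and_congr_right fun hb => ⟨fun h => ⟨h.1.trans hst, h.1⟩, fun h => ⟨h.2, ?_⟩⟩
          have := hne b hb h.2.ne
          rw [this.1]; exact this.2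
        have e2 : {b ∈ S | b < t ∧ t ≤ Function.update f a t b} = O := by
          ext b
          simp only [hO, mem_filter]
          refine and_congr_right fun hb => and_iff_left_of_imp fun h => ?_
          by_cases hba : b = a
          · simp [hba]
          · have := hne b hb hba
            rw [this.1]; exact this.2.le
        rw [e1, e2, hrank]
      · obtain ⟨e, hta⟩ := hne a ha has
        rw [e]
        -- At a later target the source `s` is already used up, since its value `t` is smaller, so
        -- the counts agree with those over `S.erase s`.
        have aux : ∀ b ∈ S, ∀ Q : α → α → Prop, ¬ Q s t →
            (Q b (Function.update f s t b) ↔ b ≠ s ∧ Q b (f b)) := by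
          intro b hb Q hQ
          by_cases hbs : b = s
          · subst hbs; simp [hQ]
          · rw [(hne b hb hbs).1]; simp [hbs]
        have e1 : {b ∈ S | b < a ∧ f a < Function.update f s t b} =
            {b ∈ S.erase s | b < a ∧ f a < f b} := by
          ext b
          rw [mem_filter, mem_filter, mem_erase, and_comm (a := b ≠ s), and_assoc]
          exact and_congr_right fun hb =>
            aux b hb (fun b y => b < a ∧ f a < y) fun h => hta.not_gt h.2
        have e2 : {b ∈ S | b < f a ∧ f a ≤ Function.update f s t b} =
            {b ∈ S.erase s | b < f a ∧ f a ≤ f b} := by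
          ext b
          rw [mem_filter, mem_filter, mem_erase, and_comm (a := b ≠ s), and_assoc]
          exact and_congr_right fun hb =>
            aux b hb (fun b y => b < f a ∧ f a ≤ y) fun h => hta.not_ge h.2
        rw [e1, e2, hfr a (by simp [ha, has])]

end Matching

/-! ### Permutations with a rank rule correspond to paths -/

section Permutations

variable {n : ℕ}

/-- The local shape of a permutation at a point. -/
def stepType (π : Equiv.Perm (Fin n)) (i : Fin n) : StepType :=
  if π i = i then none else some (decide (i < π i), decide (i < π.symm i))

/-- The number of excedance arcs `a ↦ π a` with `a < k ≤ π a`. -/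
def openCount (π : Equiv.Perm (Fin n)) (k : ℕ) : ℕ :=
  #{a : Fin n | (a : ℕ) < k ∧ k ≤ (π a : ℕ)}

/-- Every excedance value `π s` is taken at the position of rank `κ h`, starting from `0`, among
the `h` positions `a < π s` with `π a ≥ π s`. -/
def ExcedanceRank (κ : ℕ → ℕ) (π : Equiv.Perm (Fin n)) : Prop :=
  ∀ s, s < π s → #{a | a < s ∧ π s < π a} = κ #{a | a < π s ∧ π s ≤ π a}

theorem symm_apply_eq_self_iff {π : Equiv.Perm (Fin n)} {i : Fin n} : π.symm i = i ↔ π i = i := by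
  rw [Equiv.symm_apply_eq, eq_comm]

theorem stepRise_stepType (π : Equiv.Perm (Fin n)) (j : Fin n) :
    stepRise (stepType π j) = (if j < π j then 1 else 0) - (if π.symm j < j then 1 else 0) := by
  unfold stepType
  by_cases h : π j = j
  · simp [stepRise, h, symm_apply_eq_self_iff.mpr h]
  · have h' : π.symm j ≠ j := fun h' => h (symm_apply_eq_self_iff.mp h')
    rw [if_neg h]
    simp only [stepRise, decide_eq_true_eq]
    rcases lt_or_gt_of_ne h' with h1 | h1
    · simp [h1, h1.not_gt]
    · simp [h1, h1.not_gt]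

theorem stepRise_stepType_symm (π : Equiv.Perm (Fin n)) (j : Fin n) :
    stepRise (stepType π.symm j) = stepRise (stepType π j) := by
  simp only [stepType, symm_apply_eq_self_iff, Equiv.symm_symm]
  split_ifs
  · rfl
  · simp only [stepRise, decide_eq_true_eq]
    split_ifs <;> rfl

/-- The height is openings minus closings to the left of `k`. Indexing closings by their source, an
arc that also closes before `k` cancels, leaving the open ones. -/
theorem wordHeight_stepType (π : Equiv.Perm (Fin n)) (k : ℕ) :
    wordHeight (stepType π) k = openCount π k := by
  have h1 : wordHeight (stepType π) k =
      (∑ j : Fin n, if (j : ℕ) < k ∧ j < π j then (1 : ℤ) else 0) -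
        ∑ j : Fin n, if (j : ℕ) < k ∧ π.symm j < j then (1 : ℤ) else 0 := by
    rw [wordHeight, ← sum_sub_distrib]
    refine sum_congr rfl fun j _ => ?_
    rw [stepRise_stepType]
    by_cases h : (j : ℕ) < k <;> simp [h]
  rw [h1, ← Equiv.sum_comp π (fun j : Fin n => if (j : ℕ) < k ∧ π.symm j < j then (1 : ℤ) else 0),
    ← sum_sub_distrib, openCount, card_filter, Nat.cast_sum]
  refine sum_congr rfl fun j _ => ?_
  simp only [Equiv.symm_apply_apply, Fin.lt_def]
  push_cast
  split_ifs <;> omega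

/-- Inverting `π` only swaps the two kinds of level step, so excedance and deficiency arcs have the
same height function. -/
theorem openCount_symm (π : Equiv.Perm (Fin n)) (k : ℕ) : openCount π.symm k = openCount π k := by
  have h : wordHeight (stepType π.symm) k = wordHeight (stepType π) k := by
    simp [wordHeight, stepRise_stepType_symm]
  rw [wordHeight_stepType, wordHeight_stepType] at h
  exact_mod_cast h

theorem wordHeight_stepType_last (π : Equiv.Perm (Fin n)) :
    wordHeight (stepType π) n = 0 := by
  rw [wordHeight_stepType, openCount]
  simp

/-- Two permutations with the same excedance positions and excedance values that satisfy the same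
rank condition agree on all excedance values. -/
theorem ExcedanceRank.symm_apply_eq_of_excedance {κ : ℕ → ℕ} {π σ : Equiv.Perm (Fin n)}
    (hπ : ExcedanceRank κ π) (hσ : ExcedanceRank κ σ) (hpos : ∀ i, i < π i ↔ i < σ i)
    (hval : ∀ i, π.symm i < i ↔ σ.symm i < i) (t : Fin n) (ht : π.symm t < t) : π.symm t = σ.symm t := by
  induction t using WellFoundedLT.induction with
  | ind t ih =>
  -- By induction the excedance values below `t` sit at the same positions, so the sources still
  -- open at `t` are the same. The rank then singles out one of them.
  have aux : ∀ a, a < t → (t ≤ π a ↔ t ≤ σ a) := by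
    intro a ha
    constructor
    · intro h
      by_contra! hlt
      have h1 : a < σ a := (hpos a).mp (ha.trans_le h)
      have h2 := ih (σ a) hlt ((hval _).mpr (by simpa using h1))
      rw [Equiv.symm_apply_apply, Equiv.symm_apply_eq] at h2
      exact absurd h (by rw [← h2]; exact hlt.not_ge)
    · intro h
      by_contra! hlt
      have h1 : a < π a := (hpos a).mpr (ha.trans_le h)
      have h2 := ih (π a) hlt (by simpa using h1)
      rw [Equiv.symm_apply_apply, eq_comm, Equiv.symm_apply_eq] at h2
      exact absurd h (by rw [← h2]; exact hlt.not_ge)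
  have hO : (univ.filter fun a => a < t ∧ t ≤ σ a) = univ.filter fun a => a < t ∧ t ≤ π a := by
    ext a
    simp only [mem_filter, mem_univ, true_and]
    exact and_congr_right fun ha => (aux a ha).symm
  have rank : ∀ τ : Equiv.Perm (Fin n), ExcedanceRank κ τ → τ.symm t < t →
      (∀ a, a < t → (t ≤ τ a ↔ t ≤ π a)) →
      #{a | a < τ.symm t ∧ t ≤ π a} = κ #{a | a < t ∧ t ≤ τ a} := by
    intro τ hτ hlt haux
    have := hτ (τ.symm t) (by simpa using hlt)
    simp only [Equiv.apply_symm_apply] at this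
    rw [← this]
    congr 1
    ext a
    simp only [mem_filter, mem_univ, true_and]
    refine and_congr_right fun ha => ?_
    rw [← haux a (ha.trans hlt), le_iff_lt_or_eq, or_iff_left]
    rintro rfl
    simp at ha
  have rπ := rank π hπ ht fun _ _ => Iff.rfl
  have rσ := rank σ hσ ((hval t).mp ht) fun a ha => (aux a ha).symm
  rw [hO, ← rπ] at rσ
  have mono : ∀ x y : Fin n, t ≤ π x → x < y →
      #{a | a < x ∧ t ≤ π a} < #{a | a < y ∧ t ≤ π a} := by
    intro x y hx hxy
    refine card_lt_card (ssubset_iff_of_subset ?_ |>.mpr ⟨x, by simp [hx, hxy], by simp⟩)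
    intro a
    simp only [mem_filter, mem_univ, true_and]
    exact fun h => ⟨h.1.trans hxy, h.2⟩
  rcases lt_trichotomy (π.symm t) (σ.symm t) with h | h | h
  · exact absurd rσ (mono _ _ (by simp) h).ne'
  · exact h
  · refine absurd rσ (mono _ _ ?_ h).ne
    exact (aux _ ((hval t).mp ht)).mpr (by simp)

theorem stepType_eq_iff {π σ : Equiv.Perm (Fin n)} (h : stepType π = stepType σ) (i : Fin n) :
    (i < π i ↔ i < σ i) ∧ (π.symm i < i ↔ σ.symm i < i) ∧ (i < π.symm i ↔ i < σ.symm i) ∧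
      (π i < i ↔ σ i < i) := by
  have h' := congrFun h i
  have a1 := @symm_apply_eq_self_iff n π i
  have a2 := @symm_apply_eq_self_iff n σ i
  unfold stepType at h'
  split_ifs at h' with h1 h2 h2
  · simp [h1, h2, a1.mpr h1, a2.mpr h2]
  · simp only [Option.some.injEq, Prod.mk.injEq, decide_eq_decide] at h'
    omega

theorem ExcedanceRank.ext {κ : ℕ → ℕ} {π σ : Equiv.Perm (Fin n)}
    (hπ : ExcedanceRank κ π) (hπ' : ExcedanceRank κ π.symm)
    (hσ : ExcedanceRank κ σ) (hσ' : ExcedanceRank κ σ.symm) (h : stepType π = stepType σ) :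
    π = σ := by
  have hs := stepType_eq_iff h
  ext1 i
  rcases lt_trichotomy (π i) i with hi | hi | hi
  · have := hπ'.symm_apply_eq_of_excedance hσ' (fun i => (hs i).2.2.1) (fun i => by simpa using (hs i).2.2.2) i
      (by simpa using hi)
    simpa using this
  · have := hs i
    omega
  · have := hπ.symm_apply_eq_of_excedance hσ (fun i => (hs i).1) (fun i => (hs i).2.1) (π i) (by simpa using hi)
    rw [Equiv.symm_apply_apply, eq_comm, Equiv.symm_apply_eq] at this
    exact this

/-- With `p` marking sources and `q` targets, the height before `t` is the surplus of sources to its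
left. A surplus of at least `1` leaves room for `t` itself, which is the domination hypothesis of
`exists_matching`. -/
theorem exists_matching_of_wordHeight {κ : ℕ → ℕ} (hκ : ∀ h, 0 < h → κ h < h)
    (w : Fin n → StepType) (p q : StepType → Prop) [DecidablePred p] [DecidablePred q]
    (hpq : ∀ s, stepRise s = (if p s then 1 else 0) - (if q s then 1 else 0))
    (hpos : ∀ t, q (w t) → 1 ≤ wordHeight w t) (hlast : wordHeight w n = 0) :
    ∃ f : Fin n → Fin n, Set.BijOn f {i | p (w i)} {i | q (w i)} ∧ (∀ s, p (w s) → s < f s) ∧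
      ∀ s, p (w s) → #{a | p (w a) ∧ a < s ∧ f s < f a} =
        κ #{a | p (w a) ∧ a < f s ∧ f s ≤ f a} := by
  have hcount : ∀ k : ℕ, wordHeight w k =
      (#{i : Fin n | p (w i) ∧ (i : ℕ) < k} : ℤ) - #{i : Fin n | q (w i) ∧ (i : ℕ) < k} := by
    intro k
    rw [wordHeight, card_filter, card_filter, Nat.cast_sum, Nat.cast_sum, ← sum_sub_distrib]
    refine sum_congr rfl fun j _ => ?_
    rw [hpq]
    by_cases h : (j : ℕ) < k <;> simp [h]
  obtain ⟨f, h1, h2, h3⟩ := exists_matching hκ {i | q (w i)} {i | p (w i)} (by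
      have := hcount n
      rw [hlast] at this
      simp only [Fin.is_lt, and_true] at this
      omega) (by
      intro t ht
      have ht' : q (w t) := by simpa using ht
      have h1 := hpos t ht'
      rw [hcount] at h1
      have h2 : (filter (fun t' => t' ≤ t) {i | q (w i)} : Finset (Fin n)) =
          insert t (filter (fun i : Fin n => q (w i) ∧ (i : ℕ) < t) univ) := by
        ext a
        simp only [mem_filter, mem_univ, true_and, mem_insert, le_iff_lt_or_eq, Fin.lt_def]
        constructor
        · rintro ⟨h, h' | h'⟩
          · exact Or.inr ⟨h, h'⟩
          · exact Or.inl h'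
        · rintro (rfl | h)
          · exact ⟨ht', Or.inr rfl⟩
          · exact ⟨h.1, Or.inl h.2⟩
      rw [h2, card_insert_of_notMem (by simp), filter_filter]
      simp only [Fin.lt_def]
      omega)
  refine ⟨f, by simpa using h1, by simpa using h2, ?_⟩
  simpa [filter_filter] using h3

/-- The excedance part `f` of `π` and the excedance part `g` of its inverse are matched
independently. Inverting `g` and fixing the remaining points glues them to a surjection of a finite
set. -/
theorem exists_excedanceRank {κ : ℕ → ℕ} (hκ : ∀ h, 0 < h → κ h < h) (w : Fin n → StepType)
    (hpos : ∀ t a b, w t = some (a, b) → (a && b) = false → 1 ≤ wordHeight w t)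
    (hlast : wordHeight w n = 0) :
    ∃ π : Equiv.Perm (Fin n), ExcedanceRank κ π ∧ ExcedanceRank κ π.symm ∧ stepType π = w := by
  obtain ⟨f, hf, hflt, hfr⟩ := exists_matching_of_wordHeight hκ w
    (fun s => s = some (true, true) ∨ s = some (true, false))
    (fun s => s = some (true, false) ∨ s = some (false, false))
    (by rintro (_ | ⟨_ | _, _ | _⟩) <;> simp [stepRise])
    (by rintro t (h | h) <;> exact hpos t _ _ h rfl) hlast
  obtain ⟨g, hg, hglt, hgr⟩ := exists_matching_of_wordHeight hκ w
    (fun s => s = some (true, true) ∨ s = some (false, true))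
    (fun s => s = some (false, true) ∨ s = some (false, false))
    (by rintro (_ | ⟨_ | _, _ | _⟩) <;> simp [stepRise])
    (by rintro t (h | h) <;> exact hpos t _ _ h rfl) hlast
  obtain ⟨π, hπf, hπg, hπn⟩ : ∃ π : Equiv.Perm (Fin n),
      (∀ i, (w i = some (true, true) ∨ w i = some (true, false)) → π i = f i) ∧
      (∀ i, (w i = some (true, true) ∨ w i = some (false, true)) → π (g i) = i) ∧
      (∀ i, w i = none → π i = i) := by
    have hginv : ∀ i, (w i = some (false, true) ∨ w i = some (false, false)) →
        ∃ j, (w j = some (true, true) ∨ w j = some (false, true)) ∧ g j = i :=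
      fun i hi => hg.surjOn hi
    choose! g' hg'1 hg'2 using hginv
    let F : Fin n → Fin n := fun i => if w i = some (true, true) ∨ w i = some (true, false) then f i
      else if w i = none then i else g' i
    have hF1 : ∀ i, (w i = some (true, true) ∨ w i = some (true, false)) → F i = f i :=
      fun i hi => if_pos hi
    have hF2 : ∀ i, w i = none → F i = i := by
      intro i hi
      simp [F, hi]
    have hF3 : ∀ i, (w i = some (true, true) ∨ w i = some (false, true)) → F (g i) = i := by
      intro i hi
      have hm : w (g i) = some (false, true) ∨ w (g i) = some (false, false) := hg.mapsTo hi
      have : F (g i) = g' (g i) := by rcases hm with h | h <;> simp [F, h]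
      rw [this]
      exact hg.injOn (hg'1 _ hm) hi (hg'2 _ hm)
    have hsurj : Function.Surjective F := by
      intro i
      rcases hw : w i with _ | ⟨_ | _, _ | _⟩
      · exact ⟨i, hF2 i hw⟩
      · obtain ⟨j, hj, rfl⟩ := hf.surjOn (Or.inr hw : i ∈ {i | _ ∨ _})
        exact ⟨j, hF1 j hj⟩
      · exact ⟨g i, hF3 i (Or.inr hw)⟩
      · obtain ⟨j, hj, rfl⟩ := hf.surjOn (Or.inl hw : i ∈ {i | _ ∨ _})
        exact ⟨j, hF1 j hj⟩
      · exact ⟨g i, hF3 i (Or.inl hw)⟩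
    exact ⟨Equiv.ofBijective F (Finite.injective_iff_bijective.mp
      (Finite.injective_iff_surjective.mpr hsurj)), hF1, hF3, hF2⟩
  have hπg' : ∀ i, (w i = some (true, true) ∨ w i = some (false, true)) → π.symm i = g i := by
    intro i hi
    rw [Equiv.symm_apply_eq, hπg i hi]
  have hdown : ∀ i, (w i = some (false, true) ∨ w i = some (false, false)) → π i < i := by
    intro i hi
    obtain ⟨j, hj, rfl⟩ := hg.surjOn (hi : i ∈ {i | _ ∨ _})
    rw [hπg j hj]
    exact hglt j hj
  have hdown' : ∀ i, (w i = some (true, false) ∨ w i = some (false, false)) → π.symm i < i := by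
    intro i hi
    obtain ⟨j, hj, rfl⟩ := hf.surjOn (hi : i ∈ {i | _ ∨ _})
    rw [← hπf j hj, Equiv.symm_apply_apply, hπf j hj]
    exact hflt j hj
  have hup : ∀ i, (w i = some (true, true) ∨ w i = some (true, false)) ↔ i < π i := by
    intro i
    refine ⟨fun hi => (hπf i hi).symm ▸ hflt i hi, fun hi => ?_⟩
    rcases hw : w i with _ | ⟨_ | _, _ | _⟩
    · exact absurd hi (by simp [hπn i hw])
    · exact absurd hi (hdown i (Or.inr hw)).not_gt
    · exact absurd hi (hdown i (Or.inl hw)).not_gt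
    · simp
    · simp
  have hup' : ∀ i, (w i = some (true, true) ∨ w i = some (false, true)) ↔ i < π.symm i := by
    intro i
    refine ⟨fun hi => (hπg' i hi).symm ▸ hglt i hi, fun hi => ?_⟩
    rcases hw : w i with _ | ⟨_ | _, _ | _⟩
    · exact absurd hi (by simp [symm_apply_eq_self_iff.mpr (hπn i hw)])
    · exact absurd hi (hdown' i (Or.inr hw)).not_gt
    · simp
    · exact absurd hi (hdown' i (Or.inl hw)).not_gt
    · simp
  -- The matchings count ranks among sources only. This is no restriction: the inequalities being
  -- counted already force `a < τ a`.
  have transfer : ∀ (P : Fin n → Prop) [DecidablePred P] (φ : Fin n → Fin n)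
      (τ : Equiv.Perm (Fin n)), (∀ i, P i ↔ i < τ i) → (∀ i, P i → τ i = φ i) →
      (∀ s, P s → #{a | P a ∧ a < s ∧ φ s < φ a} = κ #{a | P a ∧ a < φ s ∧ φ s ≤ φ a}) →
      ExcedanceRank κ τ := by
    intro P _ φ τ hP hφ hr s hs
    have := hr s ((hP s).mpr hs)
    rw [← hφ s ((hP s).mpr hs)] at this
    have aux : ∀ (Q : Fin n → Fin n → Prop), (∀ a, Q a (τ a) → a < τ a) → ∀ a,
        (Q a (τ a) ↔ P a ∧ Q a (φ a)) := fun Q hQ a =>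
      ⟨fun h => ⟨(hP a).mpr (hQ a h), hφ a ((hP a).mpr (hQ a h)) ▸ h⟩,
        fun h => (hφ a h.1).symm ▸ h.2⟩
    simpa only [aux (fun a y => a < s ∧ τ s < y) fun a h => h.1.trans (hs.trans h.2),
      aux (fun a y => a < τ s ∧ τ s ≤ y) fun a h => h.1.trans_le h.2] using this
  refine ⟨π, transfer _ f π hup hπf hfr, transfer _ g π.symm hup' hπg' hgr, ?_⟩
  ext1 i
  have h1 := hup i
  have h2 := hup' i
  unfold stepType
  rcases hw : w i with _ | ⟨a, b⟩
  · rw [if_pos (hπn i hw)]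
  · have hne : π i ≠ i := by
      intro h
      have := symm_apply_eq_self_iff.mpr h
      have h3 := hdown i
      rw [h] at h1 h3
      rw [this] at h2
      rcases a <;> rcases b <;> simp [hw] at h1 h2 h3
    rw [if_neg hne]
    simp only [← h1, ← h2, hw]
    rcases a <;> rcases b <;> simp

end Permutations

/-! ### Inversions and the other statistics as sums over steps -/

section Weights

variable {n : ℕ}

theorem openCount_eq (π : Equiv.Perm (Fin n)) (i : Fin n) :
    openCount π i = #{a | a < i ∧ i ≤ π a} := by
  simp [openCount]

/-- Double counting of pairs with `a < i ≤ π a`. Truncated subtraction makes the terms without an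
excedance vanish. -/
theorem sum_openCount (π : Equiv.Perm (Fin n)) :
    ∑ i : Fin n, openCount π i = ∑ a : Fin n, ((π a : ℕ) - (a : ℕ)) := by
  simp only [openCount_eq, card_filter]
  rw [sum_comm]
  refine sum_congr rfl fun a _ => ?_
  rw [← card_filter, ← Fin.card_Ioc]
  congr 1
  ext i
  simp

theorem sum_openCount' (π : Equiv.Perm (Fin n)) :
    ∑ i : Fin n, openCount π i = ∑ b : Fin n, ((b : ℕ) - (π b : ℕ)) := by
  simp only [← openCount_symm π]
  rw [sum_openCount, ← Equiv.sum_comp π]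
  simp

/-- Adding the number of `a < b` with `π a < π b` completes the first count to `b`, the number of
positions before `b`, and the second to `π b`, the number of values below `π b`. -/
theorem card_left_above_add (π : Equiv.Perm (Fin n)) (b : Fin n) :
    #{a | a < b ∧ π b < π a} + (π b : ℕ) = #{a | b < a ∧ π a < π b} + (b : ℕ) := by
  have h1 : #{a | a < b ∧ π b < π a} + #{a | a < b ∧ π a < π b} = (b : ℕ) := by
    rw [← Fin.card_Iio b, ← card_union_of_disjoint]
    · congr 1
      ext a
      have : π a = π b → a = b := fun h => π.injective h
      simp only [mem_union, mem_filter, mem_univ, true_and, mem_Iio]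
      omega
    · rw [disjoint_filter]
      intro a _
      omega
  have h2 : #{a | b < a ∧ π a < π b} + #{a | a < b ∧ π a < π b} = (π b : ℕ) := by
    rw [← Fin.card_Iio (π b), ← card_map (s := Iio (π b)) π.symm.toEmbedding,
      ← card_union_of_disjoint]
    · congr 1
      ext a
      have : a = b → π a = π b := fun h => congrArg π h
      simp only [mem_union, mem_filter, mem_univ, true_and, mem_map_equiv, Equiv.symm_symm, mem_Iio]
      omega
    · rw [disjoint_filter]
      intro a _
      omega
  omega

/-- Count inversions by their right position `b`. At an excedance they are the arcs nesting over it,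
at a fixed point the open arcs. At a deficiency `card_left_above_add` turns them into `b - π b` plus
a nesting count, and the differences `b - π b` sum to the total height. -/
theorem invCount_eq (π : Equiv.Perm (Fin n)) :
    invCount π = ∑ i : Fin n, openCount π i + (∑ i : Fin n, if π i = i then openCount π i else 0) +
      (∑ s, if s < π s then #{a | a < s ∧ π s < π a} else 0) +
      ∑ s, if s < π.symm s then #{a | a < s ∧ π.symm s < π.symm a} else 0 := by
  have h0 : invCount π = ∑ b, #{a | a < b ∧ π b < π a} := by
    simp only [invCount, card_filter]
    rw [Fintype.sum_prod_type, sum_comm]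
  have h1 : (∑ s, if s < π.symm s then #{a | a < s ∧ π.symm s < π.symm a} else 0) =
      ∑ b, if π b < b then #{a | b < a ∧ π a < π b} else 0 := by
    rw [← Equiv.sum_comp π]
    refine sum_congr rfl fun b _ => ?_
    simp only [Equiv.symm_apply_apply]
    congr 1
    rw [← card_map π.symm.toEmbedding]
    congr 1
    ext a
    simp [mem_map_equiv, and_comm]
  rw [h0, h1, sum_openCount', ← sum_add_distrib, ← sum_add_distrib, ← sum_add_distrib]
  refine sum_congr rfl fun b _ => ?_
  have h2 := card_left_above_add π b
  rcases lt_trichotomy (π b) b with h | h | h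
  · have h' : (π b : ℕ) < b := h
    rw [if_neg h.ne, if_neg h.not_gt, if_pos h]
    omega
  · have : #{a | a < b ∧ π b < π a} = openCount π b := by
      rw [openCount_eq]
      congr 1
      ext a
      have : π a = π b → a = b := fun h => π.injective h
      simp only [mem_filter, mem_univ, true_and]
      omega
    simp [h, ← this]
  · have h' : (b : ℕ) < π b := h
    rw [if_neg h.ne', if_pos h, if_neg h.not_gt]
    omega

/-- The contribution to the inversion number of a step starting at height `h`. -/
def stepInv (κ : ℕ → ℕ) (h : ℕ) : StepType → ℕ
  | none => 2 * h
  | some (a, b) => h + (if b then 0 else κ h) + (if a then 0 else κ h)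

theorem ExcedanceRank.sum_eq {κ : ℕ → ℕ} {π : Equiv.Perm (Fin n)} (hπ : ExcedanceRank κ π) :
    (∑ s, if s < π s then #{a | a < s ∧ π s < π a} else 0) =
      ∑ t : Fin n, if π.symm t < t then κ (openCount π t) else 0 := by
  rw [← Equiv.sum_comp π fun t : Fin n => if π.symm t < t then κ (openCount π t) else 0]
  refine sum_congr rfl fun s _ => ?_
  rw [Equiv.symm_apply_apply]
  split_ifs with h
  · rw [hπ s h, openCount_eq]
  · rfl

theorem ExcedanceRank.invCount_eq {κ : ℕ → ℕ} {π : Equiv.Perm (Fin n)} (hπ : ExcedanceRank κ π)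
    (hπ' : ExcedanceRank κ π.symm) :
    invCount π = ∑ i : Fin n, stepInv κ (openCount π i) (stepType π i) := by
  rw [_root_.invCount_eq, hπ.sum_eq, hπ'.sum_eq, ← sum_add_distrib, ← sum_add_distrib,
    ← sum_add_distrib]
  refine sum_congr rfl fun i _ => ?_
  rw [openCount_symm, Equiv.symm_symm, stepType]
  have := @symm_apply_eq_self_iff n π i
  rcases lt_trichotomy (π i) i with h | h | h <;>
  rcases lt_trichotomy (π.symm i) i with h' | h' | h'
  all_goals first
    | (exfalso; omega)
    | simp [stepInv, h, h', h.ne, h.ne', h.not_gt, h'.not_gt]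
    | (simp [stepInv, h, h']; try omega)

/-- Number of cycle valleys `i < π(i)`, `i < π⁻¹(i)`. -/
def valleyCount (π : Equiv.Perm (Fin n)) : ℕ := #{i | i < π i ∧ i < π.symm i}

variable {R : Type*} [CommRing R]

/-- The weight of a step starting at height `h`. -/
def stepWeight (κ : ℕ → ℕ) (x v w s q : R) (h : ℕ) : StepType → R
  | none => x * q ^ stepInv κ h none
  | some (true, true) => v * s * q ^ stepInv κ h (some (true, true))
  | some (true, false) => if h = 0 then 0 else v * w * q ^ stepInv κ h (some (true, false))
  | some (false, true) => if h = 0 then 0 else q ^ stepInv κ h (some (false, true))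
  | some (false, false) => if h = 0 then 0 else q ^ stepInv κ h (some (false, false))

-- The zero branches of `stepWeight` are never reached by a permutation: an arc ending at `i` is
-- open there, so the height is positive.
set_option linter.unusedSimpArgs false in
theorem stepWeight_stepType (κ : ℕ → ℕ) (x v w s q : R) (π : Equiv.Perm (Fin n)) (i : Fin n) :
    stepWeight κ x v w s q (openCount π i) (stepType π i) =
      x ^ (if π i = i then 1 else 0) * v ^ (if i < π i then 1 else 0) *
      w ^ (if π.symm i < i ∧ i < π i then 1 else 0) *
      s ^ (if i < π i ∧ i < π.symm i then 1 else 0) *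
      q ^ stepInv κ (openCount π i) (stepType π i) := by
  have hpos : ∀ τ : Equiv.Perm (Fin n), τ.symm i < i → openCount τ i ≠ 0 := by
    intro τ h
    rw [openCount_eq]
    exact card_ne_zero.mpr ⟨τ.symm i, by simp [h]⟩
  have h1 := hpos π
  have h2 := hpos π.symm
  rw [openCount_symm, Equiv.symm_symm] at h2
  have h3 := @symm_apply_eq_self_iff n π i
  unfold stepType
  rcases lt_trichotomy (π i) i with h | h | h <;>
  rcases lt_trichotomy (π.symm i) i with h' | h' | h'
  all_goals first
    | (exfalso; omega)
    | simp [stepWeight, h, h', h.ne, h.ne', h.not_gt, h'.not_gt, h1 h']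
    | simp [stepWeight, h, h', h.ne, h.ne', h.not_gt, h'.not_gt, h2 h]
    | simp [stepWeight, h, h', h.ne, h.ne', h.not_gt, h'.not_gt]
    | simp [stepWeight, h, h']

theorem dexcCount_eq (π : Equiv.Perm (Fin n)) :
    dexcCount π = #{i | π.symm i < i ∧ i < π i} := by
  rw [dexcCount, ← card_map π.toEmbedding]
  congr 1
  ext i
  simp [mem_map_equiv]

theorem ExcedanceRank.prod_stepWeight {κ : ℕ → ℕ} {π : Equiv.Perm (Fin n)}
    (hπ : ExcedanceRank κ π) (hπ' : ExcedanceRank κ π.symm) (x v w s q : R) :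
    ∏ i : Fin n, stepWeight κ x v w s q (openCount π i) (stepType π i) =
      x ^ fpCount π * v ^ excCount π * w ^ dexcCount π * s ^ valleyCount π * q ^ invCount π := by
  simp only [stepWeight_stepType, prod_mul_distrib, prod_pow_eq_pow_sum, hπ.invCount_eq hπ',
    dexcCount_eq, fpCount, excCount, valleyCount, card_filter]

/-- The generating function of the permutations whose excedances and deficiencies satisfy the rank
condition of `κ`. -/
theorem permGF_excedanceRank {κ : ℕ → ℕ} (hκ : ∀ h, 0 < h → κ h < h) (x v w s q : R) :
    permGF (fun _ π => ExcedanceRank κ π ∧ ExcedanceRank κ π.symm)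
        (fun _ π => x ^ fpCount π * v ^ excCount π * w ^ dexcCount π * s ^ valleyCount π *
          q ^ invCount π) =
      jFraction (fun h => v * s * q ^ (2 * h - 1 + 2 * κ h))
        (fun h => if h = 0 then x else x * q ^ (2 * h) + (1 + v * w) * q ^ (h + κ h)) := by
  classical
  ext n
  rw [coeff_jFraction_eq_wordSum (ω := stepWeight κ x v w s q) rfl rfl rfl]
  · set Q := {π : Equiv.Perm (Fin n) | ExcedanceRank κ π ∧ ExcedanceRank κ π.symm} with hQ
    have inj : Set.InjOn stepType Q := fun π hπ σ hσ h => hπ.1.ext hπ.2 hσ.1 hσ.2 h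
    rw [wordSum, ← sum_subset (subset_univ ((univ.filter (· ∈ Q)).image stepType)),
      sum_image (by simpa using inj), permGF, coeff_mk]
    · refine sum_congr (by ext; simp [hQ]) fun π hπ => ?_
      have hπ' : π ∈ Q := by simpa using hπ
      simp only [Nat.cast_zero, zero_add, wordHeight_stepType_last, if_true, wordHeight_stepType,
        Int.toNat_natCast]
      exact (hπ'.1.prod_stepWeight hπ'.2 x v w s q).symm
    -- A word of nonzero weight ends at height `0` and closes arcs only at positive height, so it
    -- comes from a permutation.
    · intro u _ hu
      by_contra hne
      simp only [Nat.cast_zero, zero_add, ite_eq_right_iff, not_forall] at hne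
      obtain ⟨hlast, hprod⟩ := hne
      refine hu ?_
      obtain ⟨π, h1, h2, rfl⟩ := exists_excedanceRank hκ u (by
        intro t a b hab hfalse
        by_contra! hlt
        refine hprod (prod_eq_zero (mem_univ t) ?_)
        have h0 : (wordHeight u t).toNat = 0 := by omega
        rw [h0, hab]
        rcases a <;> rcases b <;> first | rfl | simp at hfalse) hlast
      exact mem_image_of_mem _ (by simp [hQ, h1, h2])
  -- The up step from `h` contributes the exponent `h`, the down step from `h + 1` contributes `h +
  -- 1 + 2 * κ (h + 1)`.
  · intro h
    simp only [stepWeight, stepInv, Nat.add_one_ne_zero, if_false, if_true, Bool.false_eq_true]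
    rw [mul_assoc (v * s), ← pow_add]
    congr 2
    omega
  · intro h
    rcases h with _ | h
    · simp [stepWeight, stepInv]
    · simp only [stepWeight, stepInv, Nat.add_one_ne_zero, if_false, if_true, Bool.false_eq_true]
      ring

end Weights

/-! ### Rank zero: increasing excedances and deficiencies -/

section IncreasingArcs

variable {n : ℕ}

theorem excedanceRank_zero_iff (π : Equiv.Perm (Fin n)) :
    ExcedanceRank (fun _ => 0) π ↔ IncreasingExcedances π := by
  simp only [ExcedanceRank, IncreasingExcedances, card_eq_zero, filter_eq_empty_iff, mem_univ,
    true_implies, not_and, not_lt]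
  constructor
  · intro h i j hij _ hj
    exact lt_of_le_of_ne (h j hj hij) fun he => hij.ne (π.injective he)
  · intro h s hs a ha
    by_contra! hlt
    exact (h a s ha (ha.trans (hs.trans hlt)) hs).not_gt hlt

/-- Deficiencies of `π` are excedances of its inverse, and an injective map between linear orders is
increasing exactly when its inverse is. -/
theorem increasingDeficiencies_iff (π : Equiv.Perm (Fin n)) :
    IncreasingDeficiencies π ↔ IncreasingExcedances π.symm := by
  have key : ∀ τ : Equiv.Perm (Fin n), (∀ i j, i < j → τ i < i → τ j < j → τ i < τ j) ↔
      ∀ i j, τ i < τ j → τ i < i → τ j < j → i < j := by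
    intro τ
    constructor
    · intro h i j hij hi hj
      by_contra! hle
      rcases hle.lt_or_eq with hlt | rfl
      · exact (h j i hlt hj hi).not_gt hij
      · exact hij.false
    · intro h i j hij hi hj
      by_contra! hle
      rcases hle.lt_or_eq with hlt | he
      · exact (h j i hlt hj hi).not_gt hij
      · exact hij.ne' (τ.injective he)
  rw [IncreasingDeficiencies, key, IncreasingExcedances]
  constructor
  · intro h i j hij hi hj
    exact h _ _ (by simpa using hij) (by simpa using hi) (by simpa using hj)
  · intro h i j hij hi hj
    simpa using h _ _ hij (by simpa using hi) (by simpa using hj)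

end IncreasingArcs

/-! ### Maximal rank: noncrossing arcs and unimodal noncrossing cycles -/

section NoncrossingArcs

variable {n : ℕ}

/-- No two excedance arcs `i ↦ π i`, drawn above a line, cross. -/
def NoncrossingExcedances (π : Equiv.Perm (Fin n)) : Prop :=
  ∀ i j, i < j → j < π i → ¬ π i < π j

/-- The arcs available at `π s` are that of `s`, those nesting over it, and those crossing it from
the right. The nesting ones number one less than the total exactly when none cross. -/
theorem excedanceRank_pred_iff (π : Equiv.Perm (Fin n)) :
    ExcedanceRank (fun h => h - 1) π ↔ NoncrossingExcedances π := by
  have key : ∀ s, s < π s → (#{a | a < s ∧ π s < π a} = #{a | a < π s ∧ π s ≤ π a} - 1 ↔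
      ∀ a, s < a → a < π s → ¬ π s < π a) := by
    intro s hs
    have hsplit : (univ.filter fun a => a < π s ∧ π s ≤ π a) =
        insert s ((univ.filter fun a => a < s ∧ π s < π a) ∪
          univ.filter fun a => (s < a ∧ a < π s) ∧ π s < π a) := by
      ext a
      have : π s = π a → a = s := fun h => (π.injective h).symm
      have : a = s → π s = π a := fun h => h ▸ rfl
      simp only [mem_insert, mem_union, mem_filter, mem_univ, true_and]
      omega
    rw [hsplit, card_insert_of_notMem (by simp), card_union_of_disjoint, Nat.add_sub_cancel,
      left_eq_add, card_eq_zero, filter_eq_empty_iff]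
    · simp
    · rw [disjoint_filter]
      intro a _
      omega
  constructor
  · intro h i j hij hj
    exact (key i (hij.trans hj)).mp (h i (hij.trans hj)) j hij hj
  · intro h s hs
    exact (key s hs).mpr fun a => h s a

theorem sameCycle_apply {α : Type*} (π : Equiv.Perm α) (a : α) : π.SameCycle a (π a) := by
  simp [Equiv.Perm.SameCycle.refl]

theorem sameCycle_symm_apply {α : Type*} (π : Equiv.Perm α) (a : α) :
    π.SameCycle a (π.symm a) := by
  simpa using (sameCycle_apply π (π.symm a)).symm

theorem sameCycle_pow_apply {α : Type*} (π : Equiv.Perm α) (a : α) (j : ℕ) :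
    π.SameCycle a ((π ^ j) a) := by
  simp [Equiv.Perm.SameCycle.refl]

theorem sameCycle_invariant {α : Type*} [Finite α] {τ : Equiv.Perm α} {P : α → Prop}
    (h : ∀ j, P j → P (τ j)) {j k : α} (hjk : τ.SameCycle j k) (hj : P j) : P k := by
  obtain ⟨i, rfl⟩ := hjk.exists_nat_pow_eq
  induction i with
  | zero => simpa using hj
  | succ i ih =>
    rw [pow_succ', Equiv.Perm.mul_apply]
    exact h _ (ih (sameCycle_pow_apply τ j i))

theorem exists_sameCycle_forall_le (π : Equiv.Perm (Fin n)) (i : Fin n) :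
    ∃ a, π.SameCycle i a ∧ ∀ b, π.SameCycle a b → a ≤ b := by
  classical
  obtain ⟨a, ha, hmin⟩ := exists_min_image {b | π.SameCycle i b} id ⟨i, by simp [Equiv.Perm.SameCycle.refl]⟩
  have ha' : π.SameCycle i a := by simpa using ha
  exact ⟨a, ha', fun b hb => hmin b (by simpa using ha'.trans hb)⟩

/-- The excedance arcs that start in `[v, T)` and are still open at `T` run out at some first
`T > v`; up to `T` no excedance arc from the left of `v` ends. -/
theorem NoncrossingExcedances.exists_first_return {τ : Equiv.Perm (Fin n)}
    (hτ : NoncrossingExcedances τ) (v : Fin n) (hv : v ≤ τ.symm v) :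
    ∃ T : ℕ, v < T ∧ (∀ j : Fin n, v ≤ j → j < T → τ j < T) ∧
      ∀ i, i < v → v ≤ τ i → T ≤ τ i := by
  classical
  have hex : ∃ T : ℕ, v < T ∧ ∀ j : Fin n, v ≤ j → j < T → τ j < T :=
    ⟨n, v.is_lt, fun j _ _ => (τ j).is_lt⟩
  refine ⟨Nat.find hex, (Nat.find_spec hex).1, (Nat.find_spec hex).2, fun i hi hvi => ?_⟩
  by_contra! hlt
  have hne : v ≠ τ i := by
    rintro rfl
    exact absurd hv (by simpa using hi)
  -- If the arc from `i` ended before the first return, some arc starting in `[v, τ i)` would end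
  -- beyond `τ i` and cross it.
  have hmin := Nat.find_min hex hlt
  push Not at hmin
  obtain ⟨j, hvj, hj, hτj⟩ := hmin (Fin.lt_def.mp (lt_of_le_of_ne hvi hne))
  refine hτ i j (hi.trans_le hvj) hj (lt_of_le_of_ne hτj fun he => ?_)
  exact (hi.trans_le hvj).ne (τ.injective he)

/-- Take the earlier of the first returns of `π` and of its inverse. If it is that of `π`, then `π`
cannot leave `[v, T)` upwards. Leaving downwards would give an arc of the inverse that starts left
of `v` and ends before the later return. The other case is symmetric. -/
theorem exists_interval_invariant {π : Equiv.Perm (Fin n)} (h1 : NoncrossingExcedances π)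
    (h2 : NoncrossingExcedances π.symm) (v : Fin n) (hv : v ≤ π v) (hv' : v ≤ π.symm v) :
    ∃ T : ℕ, v < T ∧ ∀ j k : Fin n, π.SameCycle j k → v ≤ j ∧ j < T → v ≤ k ∧ k < T := by
  obtain ⟨T₁, hv₁, hlt₁, hge₁⟩ := h1.exists_first_return v hv'
  obtain ⟨T₂, hv₂, hlt₂, hge₂⟩ := h2.exists_first_return v (by simpa using hv)
  rcases le_total T₁ T₂ with hT | hT
  · refine ⟨T₁, hv₁, fun j k hjk hj => ?_⟩
    refine sameCycle_invariant (P := fun j : Fin n => v ≤ j ∧ j < T₁) ?_ hjk hj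
    rintro j ⟨hvj, hj⟩
    refine ⟨?_, hlt₁ j hvj hj⟩
    by_contra! hlt
    have := hge₂ _ hlt (by simpa using hvj)
    rw [Equiv.symm_apply_apply] at this
    omega
  · refine ⟨T₂, hv₂, fun j k hjk hj => ?_⟩
    refine sameCycle_invariant (τ := π⁻¹) (P := fun j : Fin n => v ≤ j ∧ j < T₂) ?_
      (Equiv.Perm.sameCycle_inv.mpr hjk) hj
    rintro j ⟨hvj, hj⟩
    refine ⟨?_, hlt₂ j hvj hj⟩
    by_contra! hlt
    have := hge₁ (π.symm j) hlt (by simpa using hvj)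
    rw [Equiv.apply_symm_apply] at this
    omega

/-- Each cycle lies in an interval that starts at its minimum and is a union of cycles. If two
cycles cross, the interval of the one with the larger minimum meets the other cycle, hence contains
all of it, contradicting the order of the minima. -/
theorem noncrossingCycles_of_noncrossingExcedances {π : Equiv.Perm (Fin n)}
    (h1 : NoncrossingExcedances π) (h2 : NoncrossingExcedances π.symm) : NoncrossingCycles π := by
  rintro ⟨i, j, k, l, hij, hjk, hkl, hik, hjl, hnot⟩
  obtain ⟨a, hia, ha⟩ := exists_sameCycle_forall_le π i
  obtain ⟨b, hjb, hb⟩ := exists_sameCycle_forall_le π j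
  obtain ⟨T, haT, hT⟩ := exists_interval_invariant h1 h2 a (ha _ (sameCycle_apply π a))
    (ha _ (sameCycle_symm_apply π a))
  obtain ⟨U, hbU, hU⟩ := exists_interval_invariant h1 h2 b (hb _ (sameCycle_apply π b))
    (hb _ (sameCycle_symm_apply π b))
  have hi := hT a i hia.symm ⟨le_rfl, haT⟩
  have hk := hT a k (hia.symm.trans hik) ⟨le_rfl, haT⟩
  have hj := hU b j hjb.symm ⟨le_rfl, hbU⟩
  have hl := hU b l (hjb.symm.trans hjl) ⟨le_rfl, hbU⟩
  rcases lt_or_ge a b with hab | hab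
  · have := hU k a (hik.symm.trans hia) ⟨by omega, by omega⟩
    omega
  · have := hT j b hjb ⟨by omega, by omega⟩
    have hab' : a = b := by omega
    subst hab'
    exact hnot (hia.trans hjb.symm)

theorem le_of_valley {π : Equiv.Perm (Fin n)} (h1 : NoncrossingExcedances π)
    (h2 : NoncrossingExcedances π.symm) (v : Fin n) (hv : v < π v) (hv' : v < π.symm v)
    (b : Fin n) (hb : π.SameCycle v b) : v ≤ b := by
  obtain ⟨T, hvT, hT⟩ := exists_interval_invariant h1 h2 v hv.le hv'.le
  exact (hT v b hb ⟨le_rfl, hvT⟩).1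

theorem minimalPeriod_pos (π : Equiv.Perm (Fin n)) (a : Fin n) :
    0 < Function.minimalPeriod π a :=
  Function.minimalPeriod_pos_of_mem_periodicPts (π.injective.mem_periodicPts a)

theorem pow_minimalPeriod_apply (π : Equiv.Perm (Fin n)) (a : Fin n) :
    (π ^ Function.minimalPeriod π a) a = a := by
  rw [← Equiv.Perm.iterate_eq_pow, Function.iterate_minimalPeriod]

/-- A permutation in which all cycle valleys are minima of their cycles has unimodal cycles. -/
theorem unimodalCycles_of_valley {π : Equiv.Perm (Fin n)}
    (h : ∀ v, v < π v → v < π.symm v → ∀ b, π.SameCycle v b → v ≤ b) : UnimodalCycles π := by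
  intro a ha
  set k := Function.minimalPeriod π a with hk
  have hk0 : 0 < k := minimalPeriod_pos π a
  have hsucc : ∀ j, (π ^ (j + 1)) a = π ((π ^ j) a) := fun j => by
    rw [pow_succ', Equiv.Perm.mul_apply]
  have hlast : (π ^ k) a = a := pow_minimalPeriod_apply π a
  have hcyc := sameCycle_pow_apply π a
  have hinj : ∀ i < k, ∀ j < k, (π ^ i) a = (π ^ j) a → i = j := by
    intro i hi j hj hij
    rw [← Equiv.Perm.iterate_eq_pow, ← Equiv.Perm.iterate_eq_pow] at hij
    exact Function.iterate_injOn_Iio_minimalPeriod hi hj hij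
  have hex : ∃ j, (π ^ (j + 1)) a ≤ (π ^ j) a :=
    ⟨k - 1, by rw [Nat.sub_add_cancel hk0, hlast]; exact ha _ (hcyc _)⟩
  have hmk : Nat.find hex < k := by
    have : Nat.find hex ≤ k - 1 :=
      Nat.find_min' hex (by rw [Nat.sub_add_cancel hk0, hlast]; exact ha _ (hcyc _))
    omega
  -- An ascent after the first descent would create a valley, hence the cycle minimum `a`, before
  -- the cycle closes.
  have hdesc : ∀ j, Nat.find hex ≤ j → j + 1 < k → (π ^ (j + 1)) a < (π ^ j) a := by
    intro j hj
    induction j, hj using Nat.le_induction with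
    | base =>
      intro hlt
      refine lt_of_le_of_ne (Nat.find_spec hex) fun he => ?_
      have := hinj _ hlt _ hmk he
      omega
    | succ j hj ih =>
      intro hlt
      have h1 := ih (by omega)
      by_contra! hle
      rcases hle.lt_or_eq with hlt' | he
      · have h2 := h ((π ^ (j + 1)) a) (by rwa [← hsucc]) (by rw [hsucc] at h1 ⊢; simpa using h1) a
          (hcyc _).symm
        have h3 := hinj _ (by omega : j + 1 < k) 0 hk0 (le_antisymm h2 (ha _ (hcyc _)))
        omega
      · have := hinj _ (by omega) _ hlt he
        omega
  refine ⟨Nat.find hex, hmk, ?_, ?_⟩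
  · refine strictMonoOn_of_lt_add_one Set.ordConnected_Iic fun j _ _ hj => ?_
    simpa using Nat.find_min hex (Nat.lt_of_succ_le hj)
  · refine strictAntiOn_of_add_one_lt Set.ordConnected_Ico fun j _ hj hj' => ?_
    exact hdesc j hj.1 hj'.2

theorem UnimodalCycles.exists_cycle {π : Equiv.Perm (Fin n)} (h : UnimodalCycles π) (i : Fin n) :
    ∃ (s : ℕ → Fin n) (m k : ℕ), m < k ∧ (∀ j, π (s j) = s (j + 1)) ∧ s k = s 0 ∧
      StrictMonoOn s (Set.Iic m) ∧ StrictAntiOn s (Set.Ico m k) ∧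
      ∀ b, π.SameCycle i b → s 0 ≤ b ∧ ∃ j < k, s j = b := by
  obtain ⟨a, hia, ha⟩ := exists_sameCycle_forall_le π i
  obtain ⟨m, hm, hmono, hanti⟩ := h a ha
  refine ⟨fun j => (π ^ j) a, m, _, hm, fun j => by simp only [pow_succ', Equiv.Perm.mul_apply],
    pow_minimalPeriod_apply π a, hmono, hanti, fun b hb => ⟨ha b (hia.symm.trans hb), ?_⟩⟩
  obtain ⟨j, rfl⟩ := (hia.symm.trans hb).exists_nat_pow_eq
  refine ⟨j % Function.minimalPeriod π a, Nat.mod_lt _ (minimalPeriod_pos π a), ?_⟩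
  simp only [← Equiv.Perm.iterate_eq_pow, Function.iterate_mod_minimalPeriod_eq]

/-- Any point after the first in the cycle has a smaller predecessor on the ascending run, or a
smaller successor on the descending run, where the last successor is the minimum itself. -/
theorem UnimodalCycles.le_of_valley {π : Equiv.Perm (Fin n)} (h : UnimodalCycles π) (v : Fin n)
    (hv : v < π v) (hv' : v < π.symm v) (b : Fin n) (hb : π.SameCycle v b) : v ≤ b := by
  obtain ⟨s, m, k, hmk, hs, hsk, hmono, hanti, hcyc⟩ := h.exists_cycle v
  obtain ⟨h0, j, hj, hjv⟩ := hcyc v (.refl _ _)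
  rcases j with _ | p
  · exact hjv ▸ (hcyc b hb).1
  exfalso
  subst hjv
  rw [← hs p, Equiv.symm_apply_apply, hs] at hv'
  rw [hs] at hv
  rcases le_or_gt (p + 1) m with hp | hp
  · exact hv'.not_gt (hmono (Set.mem_Iic.mpr (by omega)) (Set.mem_Iic.mpr hp) (Nat.lt_succ_self p))
  · rcases (Nat.succ_le_of_lt hj).lt_or_eq with hp' | hp'
    · exact hv.not_gt (hanti ⟨by omega, by omega⟩ ⟨by omega, hp'⟩ (Nat.lt_succ_self _))
    · have : s (p + 1 + 1) = s 0 := by rw [← hsk, ← hp']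
      rw [this] at hv
      exact hv.not_ge h0

/-- Crossing arcs of different cycles make the cycles cross. In one cycle both sources lie on the
ascending run, where `i < j` forces `π i ≤ j`. -/
theorem UnimodalCycles.noncrossingExcedances {π : Equiv.Perm (Fin n)} (h : UnimodalCycles π)
    (h' : NoncrossingCycles π) : NoncrossingExcedances π := by
  intro i j hij hj hlt
  by_cases hc : π.SameCycle i j
  · obtain ⟨s, m, k, hmk, hs, hsk, hmono, hanti, hcyc⟩ := h.exists_cycle i
    have up : ∀ p < k, s 0 ≤ s p → s p < s (p + 1) → p < m := by
      intro p hp h0 hlt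
      by_contra! hmp
      rcases (Nat.succ_le_of_lt hp).lt_or_eq with hp' | hp'
      · exact hlt.not_gt (hanti ⟨hmp, hp⟩ ⟨by omega, hp'⟩ (Nat.lt_succ_self _))
      · have : s (p + 1) = s 0 := by rw [← hsk, ← hp']
        exact hlt.not_ge (this ▸ h0)
    obtain ⟨hi0, p, hp, rfl⟩ := hcyc i (.refl _ _)
    obtain ⟨hj0, r, hr, rfl⟩ := hcyc j hc
    rw [hs] at hj hlt
    rw [hs] at hlt
    have hpm := up p hp hi0 (hij.trans hj)
    have hrm := up r hr hj0 (hj.trans hlt)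
    have hpr : p < r := (hmono.lt_iff_lt (Set.mem_Iic.mpr hpm.le) (Set.mem_Iic.mpr hrm.le)).mp hij
    exact hj.not_ge (hmono.monotoneOn (Set.mem_Iic.mpr (by omega)) (Set.mem_Iic.mpr hrm.le) hpr)
  · exact h' ⟨i, j, π i, π j, hij, hj, hlt, sameCycle_apply π i, sameCycle_apply π j, hc⟩

theorem UnimodalCycles.noncrossingExcedances_symm {π : Equiv.Perm (Fin n)} (h : UnimodalCycles π)
    (h' : NoncrossingCycles π) : NoncrossingExcedances π.symm := by
  suffices key : ∀ i j, π i < π j → π j < i → ¬ i < j by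
    intro i j hij hj hlt
    exact key (π.symm i) (π.symm j) (by simpa using hij) (by simpa using hj) hlt
  intro i j hij hj hlt
  by_cases hc : π.SameCycle i j
  · obtain ⟨s, m, k, hmk, hs, hsk, hmono, hanti, hcyc⟩ := h.exists_cycle i
    have down : ∀ p, s (p + 1) < s p → m ≤ p := by
      intro p hlt
      by_contra! hpm
      exact hlt.not_gt (hmono (Set.mem_Iic.mpr hpm.le) (Set.mem_Iic.mpr hpm) (Nat.lt_succ_self _))
    obtain ⟨-, p, hp, rfl⟩ := hcyc i (.refl _ _)
    obtain ⟨-, r, hr, rfl⟩ := hcyc j hc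
    rw [hs, hs] at hij
    rw [hs] at hj
    have hpm := down p (hij.trans hj)
    have hrm := down r (hj.trans hlt)
    have hrp : r < p := by
      by_contra! hle
      exact hlt.not_ge (hanti.antitoneOn ⟨hpm, hp⟩ ⟨hrm, hr⟩ hle)
    exact hj.not_ge (hanti.antitoneOn ⟨by omega, by omega⟩ ⟨hpm, hp⟩ hrp)
  · exact h' ⟨π i, π j, i, j, hij, hj, hlt, (sameCycle_apply π i).symm, (sameCycle_apply π j).symm,
      by simpa using hc⟩

theorem unimodal_noncrossing_iff (π : Equiv.Perm (Fin n)) :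
    UnimodalCycles π ∧ NoncrossingCycles π ↔
      NoncrossingExcedances π ∧ NoncrossingExcedances π.symm :=
  ⟨fun h => ⟨h.1.noncrossingExcedances h.2, h.1.noncrossingExcedances_symm h.2⟩,
    fun h => ⟨unimodalCycles_of_valley (le_of_valley h.1 h.2),
      noncrossingCycles_of_noncrossingExcedances h.1 h.2⟩⟩

/-- In a nontrivial cycle the minimum is a valley, and by `UnimodalCycles.le_of_valley` the only
one. -/
theorem UnimodalCycles.cycCount_eq {π : Equiv.Perm (Fin n)} (h : UnimodalCycles π) :
    cycCount π = fpCount π + valleyCount π := by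
  rw [cycCount, add_comm]
  congr 1
  symm
  refine card_nbij π.cycleOf ?_ ?_ ?_
  · intro v hv
    have hv' : v < π v ∧ v < π.symm v := by simpa using hv
    rw [mem_coe, Equiv.Perm.cycleOf_mem_cycleFactorsFinset_iff, Equiv.Perm.mem_support]
    exact hv'.1.ne'
  · intro v hv u hu huv
    have hv' : v < π v ∧ v < π.symm v := by simpa using hv
    have hu' : u < π u ∧ u < π.symm u := by simpa using hu
    have hc : π.SameCycle v u :=
      (Equiv.Perm.sameCycle_iff_cycleOf_eq_of_mem_support
        (Equiv.Perm.mem_support.mpr hv'.1.ne') (Equiv.Perm.mem_support.mpr hu'.1.ne')).mpr huv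
    exact le_antisymm (h.le_of_valley v hv'.1 hv'.2 u hc) (h.le_of_valley u hu'.1 hu'.2 v hc.symm)
  · intro c hc
    have hc' : c ∈ π.cycleFactorsFinset := hc
    obtain ⟨i, hi⟩ := (Equiv.Perm.mem_cycleFactorsFinset_iff.mp hc').1.nonempty_support
    obtain ⟨a, hia, ha⟩ := exists_sameCycle_forall_le π i
    have hci := Equiv.Perm.cycle_is_cycleOf hi hc'
    have hiπ : i ∈ π.support := Equiv.Perm.mem_cycleFactorsFinset_support_le hc' hi
    have hne : π a ≠ a := Equiv.Perm.mem_support.mp ((hia.mem_support_iff).mp hiπ)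
    have hne' : π.symm a ≠ a := fun h => hne (symm_apply_eq_self_iff.mp h)
    refine ⟨a, ?_, by rw [hci, hia.cycleOf_eq]⟩
    simp only [coe_filter, mem_univ, true_and, Set.mem_ofPred_eq]
    exact ⟨lt_of_le_of_ne (ha _ (sameCycle_apply π a)) hne.symm,
      lt_of_le_of_ne (ha _ (sameCycle_symm_apply π a)) hne'.symm⟩

end NoncrossingArcs

/-! ### Specialization to the two families and the closed form -/

section GeneratingFunctions

variable {R : Type*} [CommRing R]

theorem permGF_congr {P Q : ∀ n : ℕ, Equiv.Perm (Fin n) → Prop}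
    {f g : ∀ n : ℕ, Equiv.Perm (Fin n) → R} (hPQ : ∀ n π, P n π ↔ Q n π)
    (hfg : ∀ n π, P n π → f n π = g n π) : permGF P f = permGF Q g := by
  obtain rfl : P = Q := funext fun n => funext fun π => propext (hPQ n π)
  unfold permGF
  congr 1
  funext n
  exact sum_congr rfl fun π hπ => hfg n π (by simpa using hπ)

theorem jFraction_congr {d d' l l' : ℕ → R} (hd : ∀ h, d (h + 1) = d' (h + 1))
    (hl : ∀ h, l h = l' h) : jFraction d l = jFraction d' l' := by
  have key : ∀ N h, jConvergent d l N h = jConvergent d' l' N h := by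
    intro N
    induction N with
    | zero => intro h; rfl
    | succ N ih => intro h; rw [jConvergent, jConvergent, hd, hl, ih]
  simp only [jFraction, key]

theorem permGF_unimodal_noncrossing (x v w t q : R) :
    permGF (fun _ π => UnimodalCycles π ∧ NoncrossingCycles π)
        (fun _ π => x ^ fpCount π * v ^ excCount π * w ^ dexcCount π * t ^ cycCount π *
          q ^ invCount π) =
      jFraction (fun h => v * t * q ^ (4 * h - 3))
        (fun h => if h = 0 then x * t
          else x * t * q ^ (2 * h) + (1 + v * w) * q ^ (2 * h - 1)) := by
  -- Cycles are fixed points plus valleys, so `t` enters through the fixed-point weight `x * t` and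
  -- the valley weight `t`.
  have h := permGF_excedanceRank (κ := fun h => h - 1) (fun h hh => by omega) (x * t) v w t q
  rw [permGF_congr (Q := fun _ π => ExcedanceRank (fun h => h - 1) π ∧
    ExcedanceRank (fun h => h - 1) π.symm) _ fun n π hπ => _, h]
  · refine jFraction_congr (fun h => ?_) fun h => ?_
    · congr 2
      omega
    · rcases h with _ | h
      · rfl
      · simp only [Nat.add_one_ne_zero, if_false]
        congr 3
        omega
  · intro n π
    rw [unimodal_noncrossing_iff, excedanceRank_pred_iff, excedanceRank_pred_iff]
  · intro n π hπ
    rw [hπ.1.cycCount_eq, mul_pow, pow_add]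
    ring

theorem permGF_increasing (x v w q : R) :
    permGF (fun _ π => IncreasingExcedances π ∧ IncreasingDeficiencies π)
        (fun _ π => x ^ fpCount π * v ^ excCount π * w ^ dexcCount π * q ^ invCount π) =
      jFraction (fun h => v * q ^ (2 * h - 1))
        (fun h => if h = 0 then x else x * q ^ (2 * h) + (1 + v * w) * q ^ h) := by
  have h := permGF_excedanceRank (κ := fun _ => 0) (fun h hh => hh) x v w 1 q
  simp only [one_pow, mul_one, mul_zero, add_zero] at h
  rw [← h]
  refine permGF_congr (fun n π => ?_) fun _ _ _ => rfl
  rw [increasingDeficiencies_iff, excedanceRank_zero_iff, excedanceRank_zero_iff]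

/-- A Jacobi continued fraction with constant coefficients from its second level on is an
algebraic function of degree two. -/
theorem jFraction_one_three_eq :
    ∃ S : ℚ⟦X⟧, S ^ 2 = 1 - 6 * X + 5 * X ^ 2 ∧ constantCoeff S = 1 ∧
      jFraction (fun _ => (1 : ℚ)) (fun h => if h = 0 then 1 else 3) = 2 * (1 + X + S)⁻¹ := by
  set d : ℕ → ℚ := fun _ => 1 with hd
  set l : ℕ → ℚ := fun h => if h = 0 then 1 else 3 with hl
  -- All tails from level 1 on coincide, so their common value `K` satisfies `(1 - 3 * X - X ^ 2 *
  -- K) * K = 1`.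
  have hconst : ∀ N h, jConvergent d l N (h + 2) = jConvergent d l N (h + 1) := by
    intro N
    induction N with
    | zero => intro h; rfl
    | succ N ih => intro h; rw [jConvergent, jConvergent, ih]; rfl
  have hK : jTail d l 2 = jTail d l 1 := by simp only [jTail, hconst _ 0]
  have h0 := jTail_mul d l 0
  have h1 := jTail_mul d l 1
  have hC3 : (C (3 : ℚ) : ℚ⟦X⟧) = 3 := map_ofNat C 3
  simp only [hd, hl, if_true, one_ne_zero, if_false, zero_add, Nat.reduceAdd, map_one, one_mul,
    hC3] at h0 h1
  rw [← hd, ← hl] at h0 h1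
  rw [hK] at h1
  rw [jTail_zero] at h0
  -- The square root of the discriminant `(1 - 3 * X) ^ 2 - 4 * X ^ 2` of that quadratic, expressed
  -- through its solution.
  refine ⟨1 - 3 * X - 2 * X ^ 2 * jTail d l 1, ?_, by simp, ?_⟩
  · linear_combination (-4 * X ^ 2) * h1
  · rw [PowerSeries.eq_mul_inv_iff_mul_eq (by simp)]
    linear_combination 2 * h0

end GeneratingFunctions

theorem mainTheorem11 {R : Type*} [CommRing R] (x v w t q : R) :
    -- permutations with unimodal noncrossing cycles
    permGF (fun _ π => UnimodalCycles π ∧ NoncrossingCycles π)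
        (fun _ π => x ^ fpCount π * v ^ excCount π * w ^ dexcCount π * t ^ cycCount π *
          q ^ invCount π) =
      jFraction (fun h => v * t * q ^ (4 * h - 3))
        (fun h => if h = 0 then x * t
          else x * t * q ^ (2 * h) + (1 + v * w) * q ^ (2 * h - 1)) ∧
    -- permutations with increasing excedances and increasing deficiencies
    permGF (fun _ π => IncreasingExcedances π ∧ IncreasingDeficiencies π)
        (fun _ π => x ^ fpCount π * v ^ excCount π * w ^ dexcCount π * q ^ invCount π) =
      jFraction (fun h => v * q ^ (2 * h - 1))
        (fun h => if h = 0 then x else x * q ^ (2 * h) + (1 + v * w) * q ^ h) ∧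
    -- `S` is the formal square root of `1 - 6z + 5z²` with constant coefficient `1`
    ∃ S : PowerSeries ℚ,
      S ^ 2 = 1 - 6 * PowerSeries.X + 5 * PowerSeries.X ^ 2 ∧
      PowerSeries.constantCoeff S = 1 ∧
      permGF (fun _ π => UnimodalCycles π ∧ NoncrossingCycles π) (fun _ _ => (1 : ℚ)) =
        2 * (1 + PowerSeries.X + S)⁻¹ ∧
      permGF (fun _ π => IncreasingExcedances π ∧ IncreasingDeficiencies π)
          (fun _ _ => (1 : ℚ)) =
        2 * (1 + PowerSeries.X + S)⁻¹ ∧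
      jFraction (fun _ => (1 : ℚ)) (fun h => if h = 0 then 1 else 3) =
        2 * (1 + PowerSeries.X + S)⁻¹ := by
  refine ⟨permGF_unimodal_noncrossing x v w t q, permGF_increasing x v w q, ?_⟩
  obtain ⟨S, hS, hS1, hJ⟩ := jFraction_one_three_eq
  refine ⟨S, hS, hS1, ?_, ?_, hJ⟩
  · have h := permGF_unimodal_noncrossing (1 : ℚ) 1 1 1 1
    norm_num at h
    rw [← hJ, h]
  · have h := permGF_increasing (1 : ℚ) 1 1 1
    norm_num at h
    rw [← hJ, h]
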